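/- **Setting.** Strings are finite sequences over a finite ordered alphabet $\{1,\dots,\sigma\}$, ordered lexicographically (a proper prefix is smaller; the end of a string acts as a terminator smaller than all characters). Let $S$ be a sequence of $n$ strings (repetitions allowed), with sorted version $t_1\le\dots\le t_n$. Put $L=\sum_{i=2}^n \mathrm{lcp}(t_{i-1},t_i)$, and let $D=\sum_i \max_{j\ne i}(\mathrm{lcp}(s_i,s_j)+1)$ be the distinguishing prefix size. Let $K\ge 2$ be a power of two. $K$-way LCP-mergesort returns a sequence of at most one string unchanged. It splits a longer sequence into $K$ contiguous parts whose lengths differ by at most one (some may be empty), sorts each part recursively together with its LCP array, and combines the $K$ results by $K$-way LCP-merge (also when there are fewer than $K$ strings). $K$-way LCP-merge is a tournament (loser) tree on $K$ inputs. Each player is the front string of an input together with its LCP with a common smaller string $p$. (In the initial tournament $p$ is the empty string, all LCPs being $0$; later $p$ is the string written last.) After each output the next string of that input enters with its LCP array entry, and the games on its path to the root are replayed. If the two LCPs in a game differ, the player with the larger one wins, and the loser keeps the smaller LCP. If they are equal, characters are compared from that position on until a mismatch or a terminator is found. Each inspected pair of characters counts as one (three-way) character comparison. An exhausted input is represented by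 a sentinel $\infty$, which has no characters and is recognised by a flag, without a character comparison. Running time is the number of elementary steps of a random access machine. **Theorem.** Let $K\ge2$ be a power of two. 1. For all $\sigma$, all $n\ge1$ and all sequences $S$ of $n$ strings, $K$-way LCP-mergesort outputs the sorted sequence together with its LCP array and makes fewer than $$L+n\lceil\log_K n\rceil\log_2K+n+\Bigl\lceil\frac{n-1}{K-1}\Bigr\rceil$$ character comparisons. 2. It runs in $O(D+n\log n)$ time: there is a constant $C$, depending only on $K$, such that for all $\sigma$, all $n\ge2$ and all $S$ the running time is at most $C\,(D+n\log_2 n)$. Moreover, there is one constant $C$, independent also of $K$, such that this holds for every power of two $K \ge 2$ and all $n$ of the form $n=K^d$ with $d\ge1$. -/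

import Mathlib

namespace KwayLCP

/-- A value together with the resources used to compute it: the number `cmps` of character
comparisons and the number `steps` of elementary steps of a random access machine. -/
structure Counted (β : Type) where
  val : β
  cmps : ℕ
  steps : ℕ

namespace Counted

/-- Sequential composition: the costs add up. -/
instance : Monad Counted where
  pure x := ⟨x, 0, 0⟩
  bind m f := ⟨(f m.val).val, m.cmps + (f m.val).cmps, m.steps + (f m.val).steps⟩

/-- `c` elementary steps (arithmetic, integer comparison, array read or write, assignment). -/
def tick (c : ℕ) : Counted Unit := ⟨(), 0, c⟩

/-- The loop `for i in l do f i`, collecting the results; one step of overhead per round. -/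
def collect {ι β : Type} (f : ι → Counted β) : List ι → Counted (List β)
  | [] => do
      tick 1
      pure []
  | i :: l => do
      tick 1
      let x ← f i
      let xs ← collect f l
      pure (x :: xs)

end Counted

open Counted

section Strings

variable {α : Type} [LinearOrder α]

/-- Length of the longest common prefix of two strings. A string is the list of its characters;
the end of the list plays the role of the terminator. -/
def lcp : List α → List α → ℕ
  | a :: s, b :: t => if a = b then lcp s t + 1 else 0
  | _, _ => 0

/-- The values `lcp p s₁, lcp s₁ s₂, lcp s₂ s₃, …`. -/
def lcpsFrom (p : List α) : List (List α) → List ℕ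
  | [] => []
  | s :: l => lcp p s :: lcpsFrom s l

/-- The LCP array of a sequence of strings. Its first entry, which is undefined in the usual
convention, is set to `0`. -/
def lcpArray : List (List α) → List ℕ
  | [] => []
  | s :: l => 0 :: lcpsFrom s l

/-- The sum `L` of the LCP array of the sorted input, without the first entry. -/
def lcpSum (S : List (List α)) : ℕ :=
  (lcpArray (S.insertionSort (· ≤ ·))).tail.sum

/-- The distinguishing prefix size `D`: for every string the number of its characters (possibly
including the terminator) that must be read to tell it apart from each of the others. -/
def distPrefixSize (S : List (List α)) : ℕ :=
  ∑ i : Fin S.length, (Finset.univ.erase i).sup fun j => lcp (S.get i) (S.get j) + 1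

/-- Order of two characters; `none` is the terminator, smaller than all characters. -/
def charOrder : Option α → Option α → Ordering
  | none, none => .eq
  | none, some _ => .lt
  | some _, none => .gt
  | some x, some y => cmp x y

/-- One (ternary) character comparison. -/
def charCompare (x y : Option α) : Counted Ordering := ⟨charOrder x y, 1, 1⟩

/-- The loop `while s[h] ≠ 0 and s[h] = t[h] do h++` (zero-based positions), returning the outcome
of the last comparison and the final value of `h`. -/
def charLoop (s t : List α) (h : ℕ) : Counted (Ordering × ℕ) := do
  let o ← charCompare s[h]? t[h]?
  if _hc : h < s.length ∧ o = .eq then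
    charLoop s t (h + 1)
  else
    pure (o, h)
termination_by s.length - h
decreasing_by omega

/-- LCP-Compare of the players `(a, sa, ha)` and `(b, sb, hb)`, where `ha` and `hb` are the LCPs of
`sa` and `sb` with a common smaller string. The result is `(x, hx, y, h')` with winner `x`, loser
`y`, and `h'` the LCP of the two strings. The sentinel `∞` of an exhausted input is `none`; it has no
characters and is recognised by a flag test. -/
def lcpCompare (a : ℕ) (sa : Option (List α)) (ha : ℕ) (b : ℕ) (sb : Option (List α)) (hb : ℕ) :
    Counted (ℕ × ℕ × ℕ × ℕ) := do
  tick 1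
  if ha = hb then
    match sa, sb with
    | some s, some t => do
        let r ← charLoop s t ha
        if r.1 ≠ .gt then pure (a, ha, b, r.2) else pure (b, hb, a, r.2)
    | none, some _ => pure (b, hb, a, ha)
    | _, none => pure (a, ha, b, hb)
  else if ha < hb then
    pure (b, hb, a, ha)
  else
    pure (a, ha, b, hb)

/-- The arrays `y` and `h` of the tournament tree: the loser of the game at node `v` is input `y v`,
and `h v` is its LCP with the winner of that game. Node `v ≥ 2` has the parent `⌈v / 2⌉`, the leaf
of input `k ∈ {1, …, K}` is node `K + k`, and node `1` holds the overall winner. -/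
structure LoserTree where
  y : ℕ → ℕ
  h : ℕ → ℕ

/-- Assignment `(y_v, h_v) := (x, h)`. -/
def LoserTree.set (T : LoserTree) (v x h : ℕ) : LoserTree :=
  ⟨Function.update T.y v x, Function.update T.h v h⟩

/-- The game of the ascending player `(x, h)` at node `v`. Here `s k` is the front string of
input `k`. The loser stays in the node; the result is the winner and the new tree. -/
def playAt (s : ℕ → Option (List α)) (v x h : ℕ) (T : LoserTree) :
    Counted (ℕ × ℕ × LoserTree) := do
  tick 1
  let r ← lcpCompare x (s x) h (T.y v) (s (T.y v)) (T.h v)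
  pure (r.1, r.2.1, T.set v r.2.2.1 r.2.2.2)

/-- Initialisation from one leaf `v`: play upwards while `v` is a right child, that is, until the
root of a perfect subtree is reached, and leave the winner in the parent of that root. -/
def buildUp (s : ℕ → Option (List α)) (v x h : ℕ) (T : LoserTree) : Counted LoserTree := do
  tick 1
  if _hv : v % 2 = 0 ∧ 2 < v then
    let r ← playAt s (v / 2) x h T
    buildUp s (v / 2) r.1 r.2.1 r.2.2
  else
    pure (T.set ((v + 1) / 2) x h)
termination_by v
decreasing_by omega

/-- Initialisation of the tournament tree: insert the listed inputs from left to right. -/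
def build (K hbar : ℕ) (s : ℕ → Option (List α)) : List ℕ → LoserTree → Counted LoserTree
  | [], T => do
      tick 1
      pure T
  | k :: l, T => do
      tick 1
      let T' ← buildUp s (K + k) k hbar T
      build K hbar s l T'

/-- Replay all games on the path from node `v` to the root; returns the winner with its LCP and
the new tree. -/
def replay (s : ℕ → Option (List α)) (v x h : ℕ) (T : LoserTree) :
    Counted (ℕ × ℕ × LoserTree) := do
  tick 1
  if _hv : 2 < v then
    let r ← playAt s ((v + 1) / 2) x h T
    replay s ((v + 1) / 2) r.1 r.2.1 r.2.2
  else
    pure (x, h, T)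
termination_by v
decreasing_by omega

/-- A sequence of strings with an LCP array. -/
structure Run (α : Type) where
  strs : List (List α)
  lcps : List ℕ

/-- The main loop of the `K`-way merge with `N` strings still to be written. `R k` is the `k`-th input,
`i k` the (zero-based) position of its front string, `w` the current winner and `h1` its LCP with the
string written before. -/
def outputLoop (K : ℕ) (R : ℕ → Run α) :
    (N : ℕ) → (i : ℕ → ℕ) → (w h1 : ℕ) → LoserTree → Counted (Run α)
  | 0, _, _, _, _ => do
      tick 1
      pure ⟨[], []⟩
  | N + 1, i, w, h1, T => do
      tick 1
      let i' := Function.update i w (i w + 1)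
      let r ← replay (fun k => (R k).strs[i' k]?) (K + w) w ((R w).lcps.getD (i' w) 0) T
      let out ← outputLoop K R N i' r.1 r.2.1 r.2.2
      pure ⟨(R w).strs[i w]?.getD [] :: out.strs, h1 :: out.lcps⟩

/-- `K`-way LCP-merge (`K` a power of two) of the sorted inputs `R 1, …, R K` with common prefix
length `hbar`. Initialising the `K` indices and adding up the `K` lengths is charged `2 * K` steps. -/
def kwayMerge (K hbar : ℕ) (R : ℕ → Run α) : Counted (Run α) := do
  tick (2 * K)
  let N := ∑ k ∈ Finset.Icc 1 K, (R k).strs.length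
  let T ← build K hbar (fun k => (R k).strs[0]?) (List.range' 1 K) ⟨fun _ => 0, fun _ => 0⟩
  outputLoop K R N (fun _ => 0) (T.y 1) (T.h 1) T

/-- The `k`-th (`0 ≤ k < K`) of the `K` contiguous parts of `S` of nearly even size: the first
`n % K` parts have `n / K + 1` elements, the others `n / K`. -/
def part {β : Type} (K : ℕ) (S : List β) (k : ℕ) : List β :=
  (S.drop (k * (S.length / K) + min k (S.length % K))).take
    (S.length / K + if k < S.length % K then 1 else 0)

theorem length_part_lt {β : Type} (K : ℕ) (S : List β) (k : ℕ) (hK : 2 ≤ K)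
    (hS : 2 ≤ S.length) : (part K S k).length < S.length := by
  have h1 : (part K S k).length ≤ S.length / K + if k < S.length % K then 1 else 0 :=
    List.length_take_le _ _
  have h2 := Nat.div_add_mod S.length K
  have h3 : 2 * (S.length / K) ≤ K * (S.length / K) := Nat.mul_le_mul_right _ hK
  split_ifs at h1 <;> omega

/-- `K`-way LCP-mergesort: split into `K` parts of nearly even size, sort them recursively, and
combine the results by `K`-way LCP-merge (also when there are fewer than `K` strings). -/
def mergesort (K : ℕ) (S : List (List α)) : Counted (Run α) := do
  tick 1
  if _hS : 2 ≤ K ∧ 2 ≤ S.length then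
    let runs ← collect (fun k => mergesort K (part K S k)) (List.range K)
    kwayMerge K 0 fun k => runs.getD (k - 1) ⟨[], []⟩
  else
    pure ⟨S, S.map fun _ => 0⟩
termination_by S.length
decreasing_by exact length_part_lt K S k _hS.1 _hS.2

end Strings

end KwayLCP

/-!
Every game of a tournament is between two players that carry their LCPs with a common smaller string
`p`. If the LCPs differ, the player with the longer one is the smaller string, and the LCP of the two
players is the shorter one. If they agree, the character loop raises the LCP of the loser by one in
every round but the last. Hence (`lcpCompare_spec`) a game costs the amount by which the LCP of its
loser grows, plus at most one comparison, and that one only if both players are strings.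

The LCPs act as a potential. Those of the inputs enter the tree, grow in the games, and leave as the
LCP array of the output, so that over the whole recursion the growth telescopes to `L`. What remains
is one comparison per game. Replaying costs `log₂ K` games per output string and level, in total
`n ⌈log_K n⌉ log₂ K`. The games between strings in an initial tournament are fewer than its nonempty
inputs, and summed over the recursion these are fewer than `n`. So `L + n ⌈log_K n⌉ log₂ K + n` is
already a strict upper bound.

Correctness of the loser tree is the predicate `Played`: the subtree at a node has a given winner, and
each of its nodes stores the loser of its game with the LCP of loser and winner. When the winner is
replaced by its successor, all losers on its path to the root have been compared with the string just
written, so that their LCPs are LCPs with this common smaller string; `replay_subtree` restores the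
predicate by induction on the height, and `build_subtree` establishes it. `outputLoop_spec`,
`kwayMerge_spec` and `mergesort_spec` carry correctness and the potential up to the sorting algorithm.

All steps other than character comparisons depend on the lengths of the inputs only. A merge of `N`
strings takes `O(K + N log K)` of them, which gives the running time for fixed `K`. If `n = K ^ d`,
there are `(n - 1) / (K - 1)` merges, and their setup costs `O(n)` in total, uniformly in `K`. Finally
`L ≤ D`, as every string of the sorted sequence has to be told apart from its predecessor.
-/

namespace KwayLCP


/-! ### Cost bookkeeping -/

namespace Counted

variable {β γ : Type}

/-- The computation `m` with `c` character comparisons and `t` steps added to its cost. -/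
def charge (c t : ℕ) (m : Counted β) : Counted β := ⟨m.val, c + m.cmps, t + m.steps⟩

@[simp] theorem val_charge (c t : ℕ) (m : Counted β) : (charge c t m).val = m.val := rfl
@[simp] theorem cmps_charge (c t : ℕ) (m : Counted β) : (charge c t m).cmps = c + m.cmps := rfl
@[simp] theorem steps_charge (c t : ℕ) (m : Counted β) : (charge c t m).steps = t + m.steps := rfl

@[simp] theorem val_pure (x : β) : (pure x : Counted β).val = x := rfl
@[simp] theorem cmps_pure (x : β) : (pure x : Counted β).cmps = 0 := rfl
@[simp] theorem steps_pure (x : β) : (pure x : Counted β).steps = 0 := rfl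

theorem bind_eq_charge (m : Counted β) (f : β → Counted γ) :
    m >>= f = charge m.cmps m.steps (f m.val) := rfl

theorem tick_bind (t : ℕ) (f : Unit → Counted γ) : tick t >>= f = charge 0 t (f ()) := rfl

theorem charge_bind (c t : ℕ) (m : Counted β) (f : β → Counted γ) :
    charge c t m >>= f = charge c t (m >>= f) := by
  simp [bind_eq_charge, charge, Nat.add_assoc]

theorem charge_charge (c t c' t' : ℕ) (m : Counted β) :
    charge c t (charge c' t' m) = charge (c + c') (t + t') m := by
  simp [charge, Nat.add_assoc]

theorem collect_eq {ι : Type} (f : ι → Counted β) (l : List ι) :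
    collect f l = ⟨l.map fun i => (f i).val, (l.map fun i => (f i).cmps).sum,
      (l.map fun i => (f i).steps).sum + l.length + 1⟩ := by
  induction l with
  | nil => rfl
  | cons i l ih =>
    simp only [collect, bind_eq_charge, ih, charge, tick, cmps_pure, steps_pure, val_pure,
      List.map_cons, List.sum_cons, List.length_cons, Counted.mk.injEq, true_and]
    omega

end Counted

open Counted

section Strings

variable {α : Type} [LinearOrder α]

/-! ### Longest common prefixes and the order of strings -/

@[simp] theorem nil_le (s : List α) : [] ≤ s := le_of_not_gt (List.not_lt_nil s)

theorem not_cons_le_nil (a : α) (s : List α) : ¬ a :: s ≤ [] :=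
  not_le.2 (List.nil_lt_cons a s)

theorem cons_le_cons_iff {a b : α} {s t : List α} :
    a :: s ≤ b :: t ↔ a < b ∨ a = b ∧ s ≤ t := by
  rw [le_iff_lt_or_eq, le_iff_lt_or_eq, List.cons_lt_cons_iff, List.cons.injEq]
  tauto

@[simp] theorem lcp_nil_left (s : List α) : lcp [] s = 0 := by simp [lcp]
@[simp] theorem lcp_nil_right (s : List α) : lcp s [] = 0 := by cases s <;> simp [lcp]

theorem lcp_comm (s t : List α) : lcp s t = lcp t s := by
  induction s generalizing t with
  | nil => simp
  | cons a s ih =>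
    cases t with
    | nil => simp
    | cons b t => simp only [lcp, eq_comm (a := a), ih t]

/-- The LCP is ultrametric. -/
theorem min_lcp_le (p s t : List α) : min (lcp p s) (lcp p t) ≤ lcp s t := by
  induction p generalizing s t with
  | nil => simp
  | cons c p ih =>
    cases s with
    | nil => simp
    | cons a s =>
      cases t with
      | nil => simp
      | cons b t =>
        have := ih s t
        simp only [lcp]
        split_ifs <;> first | omega | (subst_vars; contradiction)

/-- Of two strings above `p`, the one with the longer common prefix with `p` is the smaller, and
the shorter common prefix with `p` is also the common prefix of the two. -/
theorem le_and_lcp_of_lcp_lt {p s t : List α} (hs : p ≤ s) (ht : p ≤ t)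
    (h : lcp p s < lcp p t) : t ≤ s ∧ lcp s t = lcp p s := by
  induction p generalizing s t with
  | nil => simp at h
  | cons c p ih =>
    cases t with
    | nil => simp at h
    | cons b t =>
      cases s with
      | nil => exact absurd hs (not_cons_le_nil c p)
      | cons a s =>
        rw [cons_le_cons_iff] at hs ht ⊢
        simp only [lcp] at h ⊢
        by_cases hcb : c = b
        · subst hcb
          by_cases hca : c = a
          · subst hca
            simp only [if_true, lt_irrefl, false_or, true_and] at h hs ht ⊢
            obtain ⟨h1, h2⟩ := ih hs ht (by omega)
            exact ⟨h1, by omega⟩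
          · rw [if_neg (Ne.symm hca), if_neg hca]
            exact ⟨Or.inl (hs.resolve_right fun h' => hca h'.1), rfl⟩
        · simp [hcb] at h

/-- One round of the character loop at a position up to which the strings agree. -/
theorem lcp_step {s t : List α} {h : ℕ} (hh : h ≤ lcp s t) :
    (h < s.length ∧ charOrder s[h]? t[h]? = .eq → h + 1 ≤ lcp s t) ∧
    (¬ (h < s.length ∧ charOrder s[h]? t[h]? = .eq) → lcp s t = h ∧
      (charOrder s[h]? t[h]? ≠ .gt → s ≤ t) ∧ (charOrder s[h]? t[h]? = .gt → t ≤ s)) := by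
  induction s generalizing t h with
  | nil =>
    obtain rfl : h = 0 := by simpa using hh
    cases t <;> simp [charOrder]
  | cons a s ih =>
    cases t with
    | nil =>
      obtain rfl : h = 0 := by simpa using hh
      simp [charOrder]
    | cons b t =>
      cases h with
      | zero =>
        rcases lt_trichotomy a b with hab | hab | hab
        · simp [charOrder, cmp, cmpUsing, hab, lcp, hab.ne, cons_le_cons_iff]
        · simp [charOrder, lcp, hab]
        · simp [charOrder, cmp, cmpUsing, hab, lcp, hab.ne', hab.not_gt, cons_le_cons_iff]
      | succ h =>
        by_cases hab : a = b
        · subst hab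
          simp only [lcp, if_true] at hh
          have := ih (t := t) (h := h) (by omega)
          simpa [lcp, cons_le_cons_iff] using this
        · simp [lcp, hab] at hh

/-- Started at a position up to which the strings agree, the character loop makes one comparison for
each position by which it advances, and one more. -/
theorem charLoop_spec (s t : List α) (h : ℕ) (hh : h ≤ lcp s t) :
    (charLoop s t h).val.2 = lcp s t ∧
    ((charLoop s t h).val.1 ≠ .gt → s ≤ t) ∧ ((charLoop s t h).val.1 = .gt → t ≤ s) ∧
    (charLoop s t h).cmps + h = lcp s t + 1 ∧
    (charLoop s t h).steps = (charLoop s t h).cmps := by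
  obtain ⟨h1, h2⟩ := lcp_step hh
  rw [charLoop]
  by_cases hc : h < s.length ∧ charOrder s[h]? t[h]? = .eq
  · obtain ⟨i1, i2, i3, i4, i5⟩ := charLoop_spec s t (h + 1) (h1 hc)
    have hc' : h < s.length ∧ (charCompare s[h]? t[h]?).val = .eq := hc
    simp only [bind_eq_charge, dif_pos hc', val_charge, cmps_charge, steps_charge]
    simp only [charCompare]
    exact ⟨i1, i2, i3, by omega, by omega⟩
  · have hc' : ¬ (h < s.length ∧ (charCompare s[h]? t[h]?).val = .eq) := hc
    obtain ⟨h3, h4, h5⟩ := h2 hc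
    simp only [bind_eq_charge, dif_neg hc', val_charge, cmps_charge, steps_charge, val_pure,
      cmps_pure, steps_pure]
    simp only [charCompare]
    exact ⟨h3.symm, h4, h5, by omega, trivial⟩
termination_by s.length - h

/-! ### Players of the tournament -/

/-- The order of players: `none` is the sentinel, larger than every string. -/
def LeO : Option (List α) → Option (List α) → Prop
  | _, none => True
  | none, some _ => False
  | some s, some t => s ≤ t

/-- The LCP of two players; the sentinel has no characters. -/
def lcpO : Option (List α) → Option (List α) → ℕ
  | some s, some t => lcp s t
  | _, _ => 0

/-- `1` for a string and `0` for the sentinel. -/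
def real : Option (List α) → ℕ
  | some _ => 1
  | none => 0

@[simp] theorem lcpO_none (a : Option (List α)) : lcpO a none = 0 := by cases a <;> rfl
@[simp] theorem lcpO_nil (a : Option (List α)) : lcpO (some []) a = 0 := by cases a <;> simp [lcpO]
@[simp] theorem nil_leO (a : Option (List α)) : LeO (some []) a := by cases a <;> simp [LeO]

theorem LeO.refl (a : Option (List α)) : LeO a a := by cases a <;> simp [LeO]

theorem real_le_one {β : Type} (a : Option (List β)) : real a ≤ 1 := by cases a <;> simp [real]

theorem LeO.real_le {a b : Option (List α)} (h : LeO a b) : real b ≤ real a := by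
  cases a <;> cases b <;> simp_all [LeO, real]

theorem LeO.trans {a b c : Option (List α)} (h : LeO a b) (h' : LeO b c) : LeO a c := by
  cases a <;> cases b <;> cases c <;> simp_all [LeO]
  exact le_trans h h'

theorem lcpO_comm (a b : Option (List α)) : lcpO a b = lcpO b a := by
  cases a <;> cases b <;> simp [lcpO, lcp_comm]

/-- A game between two players above `p` is decided correctly. Its comparisons are paid for by the
growth of the LCP that the loser carries, apart from one comparison if the loser is a string. -/
theorem lcpCompare_spec (p : List α) (a b : ℕ) {sa sb : Option (List α)}
    (hsa : LeO (some p) sa) (hsb : LeO (some p) sb) :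
    ∃ c, (lcpCompare a sa (lcpO (some p) sa) b sb (lcpO (some p) sb)).cmps = c ∧
    (lcpCompare a sa (lcpO (some p) sa) b sb (lcpO (some p) sb)).steps = c + 1 ∧
    (((lcpCompare a sa (lcpO (some p) sa) b sb (lcpO (some p) sb)).val =
        (a, lcpO (some p) sa, b, lcpO sa sb) ∧ LeO sa sb ∧
          c + lcpO (some p) sb ≤ lcpO sa sb + real sb) ∨
     ((lcpCompare a sa (lcpO (some p) sa) b sb (lcpO (some p) sb)).val =
        (b, lcpO (some p) sb, a, lcpO sb sa) ∧ LeO sb sa ∧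
          c + lcpO (some p) sa ≤ lcpO sb sa + real sa)) := by
  refine ⟨_, rfl, ?_⟩
  rcases lt_trichotomy (lcpO (some p) sa) (lcpO (some p) sb) with h | h | h
  · rcases sb with _ | t
    · simp at h
    have h1 : LeO (some t) sa ∧ lcpO (some t) sa = lcpO (some p) sa := by
      rcases sa with _ | s
      · simp [LeO]
      · rw [lcpO_comm (some t)]
        exact le_and_lcp_of_lcp_lt hsa hsb h
    unfold lcpCompare
    simp only [tick_bind, if_neg h.ne, if_pos h]
    refine ⟨rfl, Or.inr ⟨?_, h1.1, ?_⟩⟩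
    · rw [h1.2]; rfl
    · simp [h1.2]
  · rcases sa with _ | s <;> rcases sb with _ | t
    · exact ⟨rfl, Or.inl ⟨rfl, trivial, Nat.le_refl _⟩⟩
    · unfold lcpCompare
      simp only [tick_bind, if_pos h]
      exact ⟨rfl, Or.inr ⟨rfl, trivial, Nat.le_add_right _ _⟩⟩
    · unfold lcpCompare
      simp only [tick_bind, if_pos h]
      refine ⟨rfl, Or.inl ⟨?_, trivial, ?_⟩⟩
      · simp
      · simp
    · have hl : lcp p s ≤ lcp s t := by
        have := min_lcp_le p s t
        simp only [lcpO] at h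
        omega
      obtain ⟨i1, i2, i3, i4, i5⟩ := charLoop_spec s t (lcp p s) hl
      unfold lcpCompare
      simp only [tick_bind, if_pos h]
      simp only [lcpO] at h ⊢
      by_cases hg : (charLoop s t (lcp p s)).val.1 = .gt
      · simp only [bind_eq_charge, hg, ne_eq, not_true_eq_false, if_false, val_charge, cmps_charge,
          steps_charge, cmps_pure, steps_pure, val_pure]
        refine ⟨by omega, Or.inr ⟨?_, i3 hg, ?_⟩⟩
        · rw [i1, lcp_comm t s]
        · rw [lcp_comm t s]; simp only [real]; omega
      · simp only [bind_eq_charge, hg, ne_eq, not_false_eq_true, if_true, val_charge, cmps_charge,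
          steps_charge, cmps_pure, steps_pure, val_pure]
        refine ⟨by omega, Or.inl ⟨?_, i2 hg, ?_⟩⟩
        · rw [i1]
        · simp only [real]; omega
  · rcases sa with _ | s
    · simp at h
    have h1 : LeO (some s) sb ∧ lcpO (some s) sb = lcpO (some p) sb := by
      rcases sb with _ | t
      · simp [LeO]
      · rw [lcpO_comm (some s)]
        exact le_and_lcp_of_lcp_lt hsb hsa h
    unfold lcpCompare
    simp only [tick_bind, if_neg h.ne', if_neg h.not_gt]
    refine ⟨rfl, Or.inl ⟨?_, h1.1, ?_⟩⟩
    · rw [h1.2]; rfl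
    · simp [h1.2]

/-! ### The tournament tree -/

/-- `v` lies in the subtree rooted at `u`, in heap numbering: the children of `u` are `2 * u` and
`2 * u + 1`. Array position `v + 1` of a `LoserTree` belongs to the node `v` of the heap, so that
its root is `1`, and the leaf of input `k` is the node `v` with `v + 1 = K + k`. -/
def InSubtree (u v : ℕ) : Prop := ∃ i, v / 2 ^ i = u

theorem InSubtree.self (u : ℕ) : InSubtree u u := ⟨0, by simp⟩

theorem InSubtree.of_child {u a v : ℕ} (ha : a / 2 = u) (h : InSubtree a v) : InSubtree u v := by
  obtain ⟨i, hi⟩ := h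
  exact ⟨i + 1, by rw [pow_succ, ← Nat.div_div_eq_div_mul, hi, ha]⟩

theorem InSubtree.left {u v : ℕ} (h : InSubtree (2 * u) v) : InSubtree u v :=
  h.of_child (by omega)

theorem InSubtree.right {u v : ℕ} (h : InSubtree (2 * u + 1) v) : InSubtree u v :=
  h.of_child (by omega)

theorem InSubtree.le {u v : ℕ} (h : InSubtree u v) : u ≤ v := by
  obtain ⟨i, rfl⟩ := h
  exact Nat.div_le_self _ _

theorem InSubtree.not_left {u v : ℕ} (hu : 1 ≤ u) (h : InSubtree (2 * u) v) :
    ¬ InSubtree (2 * u + 1) v := by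
  rintro ⟨i', h'⟩
  obtain ⟨i, h⟩ := h
  rcases lt_trichotomy i i' with hi | rfl | hi
  · obtain ⟨d, rfl⟩ := Nat.exists_eq_add_of_lt hi
    rw [Nat.add_assoc, pow_add, ← Nat.div_div_eq_div_mul, h] at h'
    have := Nat.div_le_self (2 * u) (2 ^ (d + 1))
    omega
  · omega
  · obtain ⟨d, rfl⟩ := Nat.exists_eq_add_of_lt hi
    rw [Nat.add_assoc, pow_add, ← Nat.div_div_eq_div_mul, h', pow_succ', ← Nat.div_div_eq_div_mul]
      at h
    have := Nat.div_le_self ((2 * u + 1) / 2) (2 ^ d)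
    omega

/-- The subtree of height `j` at the node `u` holds the correct results of its games, and its winner
is input `x`: every node stores the loser of its game together with the LCP of the two players. -/
def Played (K : ℕ) (s : ℕ → Option (List α)) (T : LoserTree) : ℕ → ℕ → ℕ → Prop
  | 0, u, x => u + 1 = K + x
  | j + 1, u, x =>
      ((Played K s T j (2 * u) x ∧ Played K s T j (2 * u + 1) (T.y (u + 1))) ∨
        (Played K s T j (2 * u) (T.y (u + 1)) ∧ Played K s T j (2 * u + 1) x)) ∧
      LeO (s x) (s (T.y (u + 1))) ∧ T.h (u + 1) = lcpO (s x) (s (T.y (u + 1)))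

/-- The sum of the LCPs stored in the subtree of height `j` at the node `u`. -/
def treeSum (T : LoserTree) : ℕ → ℕ → ℕ
  | 0, _ => 0
  | j + 1, u => T.h (u + 1) + treeSum T j (2 * u) + treeSum T j (2 * u + 1)

/-- The trees `T` and `T'` agree outside the subtree at `u`. -/
def AgreeOff (T T' : LoserTree) (u : ℕ) : Prop :=
  ∀ v, ¬ InSubtree u v → T'.y (v + 1) = T.y (v + 1) ∧ T'.h (v + 1) = T.h (v + 1)

variable {K : ℕ} {s s' : ℕ → Option (List α)} {T T' : LoserTree}

theorem Played.congr {j u x : ℕ} (h : Played K s T j u x)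
    (hs : ∀ v k, v + 1 = K + k → InSubtree u v → s' k = s k)
    (hT : ∀ v, InSubtree u v → T'.y (v + 1) = T.y (v + 1) ∧ T'.h (v + 1) = T.h (v + 1)) :
    Played K s' T' j u x ∧ s' x = s x := by
  induction j generalizing u x with
  | zero => exact ⟨h, hs u x h (.self u)⟩
  | succ j ih =>
    obtain ⟨h1, h2, h3⟩ := h
    have hu := hT u (.self u)
    have hl := fun x (hx : Played K s T j (2 * u) x) => ih hx (fun v k hv h => hs v k hv h.left)
      (fun v h => hT v h.left)
    have hr := fun x (hx : Played K s T j (2 * u + 1) x) => ih hx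
      (fun v k hv h => hs v k hv h.right) (fun v h => hT v h.right)
    simp only [Played, hu]
    rcases h1 with ⟨h1, h1'⟩ | ⟨h1, h1'⟩
    · rw [(hl _ h1).2, (hr _ h1').2]
      exact ⟨⟨Or.inl ⟨(hl _ h1).1, (hr _ h1').1⟩, h2, h3⟩, rfl⟩
    · rw [(hl _ h1).2, (hr _ h1').2]
      exact ⟨⟨Or.inr ⟨(hl _ h1).1, (hr _ h1').1⟩, h2, h3⟩, rfl⟩

theorem treeSum_congr {j u : ℕ}
    (hT : ∀ v, InSubtree u v → T'.y (v + 1) = T.y (v + 1) ∧ T'.h (v + 1) = T.h (v + 1)) :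
    treeSum T' j u = treeSum T j u := by
  induction j generalizing u with
  | zero => rfl
  | succ j ih =>
    simp only [treeSum, (hT u (.self u)).2, ih fun v h => hT v h.left, ih fun v h => hT v h.right]

theorem Played.exists_leaf {j u x : ℕ} (h : Played K s T j u x) :
    ∃ v, v + 1 = K + x ∧ v / 2 ^ j = u := by
  induction j generalizing u x with
  | zero => exact ⟨u, h, by simp⟩
  | succ j ih =>
    rcases h.1 with ⟨h1, -⟩ | ⟨-, h1⟩ <;> obtain ⟨v, hv, hv'⟩ := ih h1 <;>
      exact ⟨v, hv, by rw [pow_succ, ← Nat.div_div_eq_div_mul, hv']; omega⟩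

theorem Played.le {j u x : ℕ} (h : Played K s T j u x) {v k : ℕ} (hv : v + 1 = K + k)
    (hvu : v / 2 ^ j = u) : LeO (s x) (s k) := by
  induction j generalizing u x with
  | zero =>
    simp only [pow_zero, Nat.div_one] at hvu
    obtain rfl : k = x := by simp only [Played] at h; omega
    exact .refl _
  | succ j ih =>
    rw [pow_succ, ← Nat.div_div_eq_div_mul] at hvu
    obtain ⟨h1, h2, -⟩ := h
    obtain hc | hc : v / 2 ^ j = 2 * u ∨ v / 2 ^ j = 2 * u + 1 := by omega
    · rcases h1 with ⟨h1, -⟩ | ⟨h1, -⟩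
      · exact ih h1 hc
      · exact h2.trans (ih h1 hc)
    · rcases h1 with ⟨-, h1⟩ | ⟨-, h1⟩
      · exact h2.trans (ih h1 hc)
      · exact ih h1 hc

/-- If all inputs are exhausted, then all stored LCPs are zero. -/
theorem Played.treeSum_eq_zero {j u x : ℕ} (h : Played K s T j u x)
    (hs : ∀ v k, v + 1 = K + k → v / 2 ^ j = u → s k = none) : treeSum T j u = 0 := by
  induction j generalizing u x with
  | zero => rfl
  | succ j ih =>
    have hs' : ∀ a v k, a / 2 = u → v + 1 = K + k → v / 2 ^ j = a → s k = none :=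
      fun a v k ha hv h => hs v k hv (by rw [pow_succ, ← Nat.div_div_eq_div_mul, h, ha])
    have hs1 := hs' (2 * u)
    have hs2 := hs' (2 * u + 1)
    obtain ⟨h1, h2, h3⟩ := h
    rcases h1 with ⟨h1, h1'⟩ | ⟨h1, h1'⟩
    · obtain ⟨v, hv, hv'⟩ := h1'.exists_leaf
      simp only [treeSum, ih h1 fun v k => hs1 v k (by omega),
        ih h1' fun v k => hs2 v k (by omega), h3, hs2 v _ (by omega) hv hv', lcpO_none]
    · obtain ⟨v, hv, hv'⟩ := h1.exists_leaf
      simp only [treeSum, ih h1 fun v k => hs1 v k (by omega),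
        ih h1' fun v k => hs2 v k (by omega), h3, hs1 v _ (by omega) hv hv', lcpO_none]

/-- Two adjacent subtrees of height `j` are joined by the game at their parent `u`. The winner of
one of them, `a`, ascends, and the winner `b` of the other waits in the node. -/
theorem playAt_spec {p : List α} {j u a b : ℕ} (hu : 1 ≤ u)
    (hab : (Played K s T j (2 * u) a ∧ Played K s T j (2 * u + 1) b) ∨
      (Played K s T j (2 * u) b ∧ Played K s T j (2 * u + 1) a))
    (hpa : LeO (some p) (s a)) (hpb : LeO (some p) (s b)) (hy : T.y (u + 1) = b)
    (hh : T.h (u + 1) = lcpO (some p) (s b)) :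
    ∃ x T' c, (∀ {β : Type} (f : ℕ × ℕ × LoserTree → Counted β),
        playAt s (u + 1) a (lcpO (some p) (s a)) T >>= f =
          charge c (c + 2) (f (x, lcpO (some p) (s x), T'))) ∧
      Played K s T' (j + 1) u x ∧ LeO (some p) (s x) ∧ AgreeOff T T' u ∧
      c + lcpO (some p) (s a) + treeSum T (j + 1) u + real (s x) ≤
        lcpO (some p) (s x) + treeSum T' (j + 1) u + real (s a) + real (s b) := by
  obtain ⟨c, hc, hst, h⟩ := lcpCompare_spec p a b hpa hpb
  obtain ⟨x, y, hxy, hval, hle, hcost⟩ : ∃ x y, ((x = a ∧ y = b) ∨ (x = b ∧ y = a)) ∧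
      (lcpCompare a (s a) (lcpO (some p) (s a)) b (s b) (lcpO (some p) (s b))).val =
        (x, lcpO (some p) (s x), y, lcpO (s x) (s y)) ∧ LeO (s x) (s y) ∧
      c + lcpO (some p) (s y) ≤ lcpO (s x) (s y) + real (s y) := by
    rcases h with ⟨h1, h2, h3⟩ | ⟨h1, h2, h3⟩
    · exact ⟨a, b, Or.inl ⟨rfl, rfl⟩, h1, h2, h3⟩
    · exact ⟨b, a, Or.inr ⟨rfl, rfl⟩, h1, h2, h3⟩
  set T' := T.set (u + 1) y (lcpO (s x) (s y)) with hT'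
  have hy' : T'.y (u + 1) = y := by simp [hT', LoserTree.set]
  have hh' : T'.h (u + 1) = lcpO (s x) (s y) := by simp [hT', LoserTree.set]
  have hoff : ∀ v, v ≠ u → T'.y (v + 1) = T.y (v + 1) ∧ T'.h (v + 1) = T.h (v + 1) := by
    intro v hv
    simp [hT', LoserTree.set, hv]
  have hl : ∀ v, InSubtree (2 * u) v → T'.y (v + 1) = T.y (v + 1) ∧ T'.h (v + 1) = T.h (v + 1) :=
    fun v hv => hoff v (by have := hv.le; omega)
  have hr : ∀ v, InSubtree (2 * u + 1) v →
      T'.y (v + 1) = T.y (v + 1) ∧ T'.h (v + 1) = T.h (v + 1) :=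
    fun v hv => hoff v (by have := hv.le; omega)
  refine ⟨x, T', c, ?_, ⟨?_, ?_, ?_⟩, ?_, ?_, ?_⟩
  · intro β f
    simp only [playAt, tick, bind_eq_charge, hy, hh, hval, hc, hst, charge_charge,
      val_charge, cmps_charge, steps_charge, val_pure, cmps_pure, steps_pure]
    congr 1
    · omega
    · omega
  · have hl' : ∀ z, Played K s T j (2 * u) z → Played K s T' j (2 * u) z :=
      fun z hz => (hz.congr (fun _ _ _ _ => rfl) hl).1
    have hr' : ∀ z, Played K s T j (2 * u + 1) z → Played K s T' j (2 * u + 1) z :=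
      fun z hz => (hz.congr (fun _ _ _ _ => rfl) hr).1
    rw [hy']
    rcases hxy with ⟨rfl, rfl⟩ | ⟨rfl, rfl⟩ <;> rcases hab with ⟨h1, h2⟩ | ⟨h1, h2⟩ <;>
      first
      | exact Or.inl ⟨hl' _ h1, hr' _ h2⟩
      | exact Or.inr ⟨hl' _ h1, hr' _ h2⟩
  · rw [hy']; exact hle
  · rw [hy']; exact hh'
  · rcases hxy with ⟨rfl, rfl⟩ | ⟨rfl, rfl⟩ <;> assumption
  · exact fun v hv => hoff v fun h => hv (h ▸ .self u)
  · simp only [treeSum, treeSum_congr hl, treeSum_congr hr, hh', hh]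
    rcases hxy with ⟨rfl, rfl⟩ | ⟨rfl, rfl⟩ <;> omega

/-- Replaying the games of input `w`, whose front string `p` has been replaced by a larger one, up to
the root of a subtree that `w` had won. -/
theorem replay_subtree {p : List α} {w : ℕ} (hs : ∀ k, k ≠ w → s' k = s k) (hp : s w = some p)
    (hle : LeO (some p) (s' w)) {j u : ℕ} (hu : 1 ≤ u) (hT : Played K s T j u w) :
    ∃ x T' c, replay s' (K + w) w (lcpO (some p) (s' w)) T =
        charge c (c + 3 * j) (replay s' (u + 1) x (lcpO (some p) (s' x)) T') ∧
      Played K s' T' j u x ∧ LeO (some p) (s' x) ∧ AgreeOff T T' u ∧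
      c + lcpO (some p) (s' w) + treeSum T j u ≤ j + lcpO (some p) (s' x) + treeSum T' j u := by
  induction j generalizing u with
  | zero =>
    have hT0 : u + 1 = K + w := hT
    exact ⟨w, T, 0, by simp [hT0, charge], hT0, hle, fun _ _ => ⟨rfl, rfl⟩, by simp⟩
  | succ j ih =>
    obtain ⟨h1, h2, h3⟩ := hT
    rw [hp] at h2 h3
    set b := T.y (u + 1) with hb
    -- `a` is the child of `u` below which `w` lies, `a'` its sibling
    obtain ⟨a, a', haa, hwa, hba⟩ : ∃ a a', ((a = 2 * u ∧ a' = 2 * u + 1) ∨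
        (a = 2 * u + 1 ∧ a' = 2 * u)) ∧ Played K s T j a w ∧ Played K s T j a' b := by
      rcases h1 with ⟨h1, h1'⟩ | ⟨h1, h1'⟩
      · exact ⟨_, _, Or.inl ⟨rfl, rfl⟩, h1, h1'⟩
      · exact ⟨_, _, Or.inr ⟨rfl, rfl⟩, h1', h1⟩
    have hdisj : ∀ v, InSubtree a v → ¬ InSubtree a' v := by
      rcases haa with ⟨rfl, rfl⟩ | ⟨rfl, rfl⟩
      · exact fun v hv => hv.not_left hu
      · exact fun v hv hv' => hv'.not_left hu hv
    have ha2 : a / 2 = u := by omega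
    have hau : ¬ InSubtree a u := fun h => by have := h.le; omega
    obtain ⟨x, T1, c, e1, hx, hpx, hoff, hc⟩ := ih (u := a) (by omega) hwa
    obtain ⟨vw, hvw, hvw'⟩ := hwa.exists_leaf
    have hT1 : ∀ v, InSubtree a' v → T1.y (v + 1) = T.y (v + 1) ∧ T1.h (v + 1) = T.h (v + 1) :=
      fun v hv => hoff v fun hv' => hdisj v hv' hv
    obtain ⟨hba', hsb⟩ := hba.congr (s' := s') (T' := T1) (fun v k hvk hv => hs k fun hkw => by
      obtain rfl : v = vw := by omega
      exact hdisj v ⟨_, hvw'⟩ hv) hT1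
    obtain ⟨hy1, hh1⟩ := hoff u hau
    rw [← hsb] at h2 h3
    obtain ⟨z, T2, c', e2, hz, hpz, hoff2, hc'⟩ := playAt_spec (K := K) (s := s') (T := T1) (p := p)
      (j := j) (a := x) (b := b) hu (by
        rcases haa with ⟨rfl, rfl⟩ | ⟨rfl, rfl⟩
        · exact Or.inl ⟨hx, hba'⟩
        · exact Or.inr ⟨hba', hx⟩) hpx h2 hy1 (hh1.trans h3)
    refine ⟨z, T2, c + c', ?_, hz, hpz, ?_, ?_⟩
    · rw [e1]
      conv_lhs => rw [replay]
      rw [dif_pos (by omega), show (a + 1 + 1) / 2 = u + 1 by omega]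
      rw [e2, tick_bind, charge_charge, charge_charge]
      congr 1
      omega
    · intro v hv
      have hva : ¬ InSubtree a v := fun h => hv (h.of_child ha2)
      rw [(hoff2 v hv).1, (hoff2 v hv).2]
      exact hoff v hva
    · have h4 := treeSum_congr (j := j) hT1
      have h5 : real (s' x) + real (s' b) ≤ 1 + real (s' z) := by
        obtain ⟨vb, hvb, hvb'⟩ := hba.exists_leaf
        have h8 : LeO (s' z) (s' b) := hz.le hvb (by
          rw [pow_succ, ← Nat.div_div_eq_div_mul, hvb']
          omega)
        have := h8.real_le
        have := real_le_one (s' x)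
        omega
      have h6 : treeSum T (j + 1) u = T.h (u + 1) + treeSum T j a + treeSum T j a' := by
        rcases haa with ⟨rfl, rfl⟩ | ⟨rfl, rfl⟩
        · rfl
        · simp only [treeSum]; omega
      have h7 : treeSum T1 (j + 1) u = T1.h (u + 1) + treeSum T1 j a + treeSum T1 j a' := by
        rcases haa with ⟨rfl, rfl⟩ | ⟨rfl, rfl⟩
        · rfl
        · simp only [treeSum]; omega
      omega

/-- Inserting the inputs below the node `u` plays all games of its subtree, and the winner ascends
from `u`. The comparisons beyond the LCPs gained are fewer than the strings below `u`. -/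
theorem build_subtree {j u k₀ : ℕ} (hu : 1 ≤ u) (hk : u * 2 ^ j + 1 = K + k₀)
    (hT : ∀ v, InSubtree u v → T.h (v + 1) = 0) (l : List ℕ) :
    ∃ x T' c t, t + 4 = 5 * 2 ^ j ∧
      build K 0 s (List.range' k₀ (2 ^ j) ++ l) T =
        charge c (c + t) (buildUp s (u + 1) x 0 T' >>= build K 0 s l) ∧
      Played K s T' j u x ∧ AgreeOff T T' u ∧
      c + real (s x) ≤ treeSum T' j u + ((List.range' k₀ (2 ^ j)).map fun k => real (s k)).sum := by
  induction j generalizing u k₀ T l with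
  | zero =>
    refine ⟨k₀, T, 0, 1, rfl, ?_, by simpa [Played] using hk, fun _ _ => ⟨rfl, rfl⟩, by simp⟩
    have hk' : K + k₀ = u + 1 := by omega
    rw [pow_zero, List.range'_one, List.singleton_append, build, tick_bind, hk']
  | succ j ih =>
    have hu1 : ¬ InSubtree (2 * u) u := fun h => by have := h.le; omega
    have hu2 : ¬ InSubtree (2 * u + 1) u := fun h => by have := h.le; omega
    have hsplit : List.range' k₀ (2 ^ (j + 1)) =
        List.range' k₀ (2 ^ j) ++ List.range' (k₀ + 2 ^ j) (2 ^ j) := by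
      have := @List.range'_append k₀ (2 ^ j) (2 ^ j) 1
      rw [one_mul] at this
      rw [this, pow_succ, mul_two]
    obtain ⟨a, T₁, c₁, t₁, ht₁, e₁, hp₁, hoff₁, hc₁⟩ := ih (u := 2 * u) (k₀ := k₀) (T := T)
      (by omega) (by rw [← hk, pow_succ]; ring) (fun v hv => hT v hv.left)
      (List.range' (k₀ + 2 ^ j) (2 ^ j) ++ l)
    set T₂ := T₁.set (u + 1) a 0 with hT₂
    have hy₂ : T₂.y (u + 1) = a := by simp [hT₂, LoserTree.set]
    have hh₂ : T₂.h (u + 1) = 0 := by simp [hT₂, LoserTree.set]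
    have hoff₂ : ∀ v, v ≠ u → T₂.y (v + 1) = T₁.y (v + 1) ∧ T₂.h (v + 1) = T₁.h (v + 1) := by
      intro v hv
      simp [hT₂, LoserTree.set, hv]
    have hne : ∀ v, InSubtree (2 * u + 1) v → v ≠ u := fun v hv h => hu2 (h ▸ hv)
    have hne' : ∀ v, InSubtree (2 * u) v → v ≠ u := fun v hv h => hu1 (h ▸ hv)
    obtain ⟨b, T₃, c₃, t₃, ht₃, e₃, hp₃, hoff₃, hc₃⟩ := ih (u := 2 * u + 1) (k₀ := k₀ + 2 ^ j)
      (T := T₂) (by omega) (by rw [← Nat.add_assoc, ← hk, pow_succ]; ring)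
      (fun v hv => by
        rw [(hoff₂ v (hne v hv)).2, (hoff₁ v fun h => h.not_left hu hv).2, hT v hv.right]) l
    have hT₃ : ∀ v, InSubtree (2 * u) v →
        T₃.y (v + 1) = T₁.y (v + 1) ∧ T₃.h (v + 1) = T₁.h (v + 1) := fun v hv => by
      rw [← (hoff₂ v (hne' v hv)).1, ← (hoff₂ v (hne' v hv)).2]
      exact hoff₃ v (hv.not_left hu)
    obtain ⟨x, T₄, c₄, e₄, hp₄, -, hoff₄, hc₄⟩ := playAt_spec (K := K) (s := s) (T := T₃) (p := [])
      (j := j) (a := b) (b := a) hu (Or.inr ⟨(hp₁.congr (fun _ _ _ _ => rfl) hT₃).1, hp₃⟩) (by simp)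
      (by simp) ((hoff₃ u hu2).1.trans hy₂) (by rw [(hoff₃ u hu2).2, hh₂]; simp)
    simp only [lcpO_nil] at e₄ hc₄
    refine ⟨x, T₄, c₁ + c₃ + c₄, t₁ + t₃ + 4, by rw [pow_succ]; omega, ?_, hp₄, ?_, ?_⟩
    · rw [hsplit, List.append_assoc, e₁]
      conv_lhs => rw [buildUp]
      rw [dif_neg (by omega), show (2 * u + 1 + 1) / 2 = u + 1 by omega, ← hT₂, tick_bind,
        charge_bind, charge_charge, show pure T₂ >>= _ = charge 0 0 _ from rfl, charge_charge,
        val_pure, e₃, charge_charge]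
      conv_lhs => rw [buildUp]
      rw [dif_pos (by omega), show (2 * u + 1 + 1) / 2 = u + 1 by omega, tick_bind, e₄, charge_charge,
        charge_bind, charge_charge]
      congr 1
      · omega
      · omega
    · intro v hv
      have hv1 : ¬ InSubtree (2 * u) v := fun h => hv h.left
      have hv2 : ¬ InSubtree (2 * u + 1) v := fun h => hv h.right
      have hvu : v ≠ u := fun h => hv (h ▸ .self u)
      rw [(hoff₄ v hv).1, (hoff₄ v hv).2, (hoff₃ v hv2).1, (hoff₃ v hv2).2, (hoff₂ v hvu).1,
        (hoff₂ v hvu).2]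
      exact hoff₁ v hv1
    · rw [hsplit, List.map_append, List.sum_append]
      have h5 : treeSum T₃ (j + 1) u = treeSum T₁ j (2 * u) + treeSum T₃ j (2 * u + 1) := by
        rw [treeSum, (hoff₃ u hu2).2, hh₂, treeSum_congr hT₃, Nat.zero_add]
      omega

/-! ### The output loop -/

theorem length_lcpsFrom (p : List α) (l : List (List α)) : (lcpsFrom p l).length = l.length := by
  induction l generalizing p with
  | nil => rfl
  | cons s l ih => simp [lcpsFrom, ih]

theorem length_lcpArray (l : List (List α)) : (lcpArray l).length = l.length := by
  cases l <;> simp [lcpArray, length_lcpsFrom]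

theorem getD_lcpsFrom (p : List α) (l : List (List α)) (i : ℕ) :
    (lcpsFrom p l).getD i 0 = lcpO (p :: l)[i]? l[i]? := by
  induction l generalizing p i with
  | nil => simp [lcpsFrom]
  | cons s l ih =>
    cases i with
    | zero => simp [lcpsFrom, lcpO]
    | succ i => simpa [lcpsFrom] using ih s i

theorem getD_lcpArray_succ (l : List (List α)) (i : ℕ) :
    (lcpArray l).getD (i + 1) 0 = lcpO l[i]? l[i + 1]? := by
  cases l with
  | nil => simp [lcpArray]
  | cons s l => simpa [lcpArray] using getD_lcpsFrom s l i

theorem lcpsFrom_nil (l : List (List α)) : lcpsFrom [] l = lcpArray l := by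
  cases l <;> simp [lcpsFrom, lcpArray]

theorem sum_eq_add_of_eq_off {M : Type} [AddCommMonoid M] {S : Finset ℕ} {f g : ℕ → M} {w : ℕ} {c : M}
    (hw : w ∈ S) (hfg : ∀ k, k ≠ w → f k = g k) (h : f w = c + g w) :
    ∑ k ∈ S, f k = c + ∑ k ∈ S, g k := by
  rw [← Finset.add_sum_erase S f hw, ← Finset.add_sum_erase S g hw, h, add_assoc]
  congr 2
  exact Finset.sum_congr rfl fun k hk => hfg k (Finset.ne_of_mem_erase hk)

theorem leaf_div {m k : ℕ} (hK : K = 2 ^ m) (h1 : 1 ≤ k) (h2 : k ≤ K) :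
    K + k - 1 + 1 = K + k ∧ (K + k - 1) / 2 ^ m = 1 := by
  refine ⟨by omega, ?_⟩
  rw [← hK]
  exact Nat.div_eq_of_lt_le (by omega) (by omega)

theorem Played.mem_Icc {m w : ℕ} (hK : K = 2 ^ m) (hT : Played K s T m 1 w) :
    w ∈ Finset.Icc 1 K := by
  obtain ⟨v, hv, hv'⟩ := hT.exists_leaf
  rw [← hK] at hv'
  have h1 := Nat.div_add_mod v K
  have h2 := Nat.mod_lt v (show 0 < K by rw [hK]; positivity)
  rw [hv', mul_one] at h1
  rw [Finset.mem_Icc]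
  omega

/-- A run is a sorted sequence of strings with its LCP array. -/
def Run.IsSorted (r : Run α) : Prop := r.strs.Pairwise (· ≤ ·) ∧ r.lcps = lcpArray r.strs

/-- The output loop writes what is left of the inputs in sorted order. The LCPs that have not been
written yet (of the winner, in the tree, and in the inputs), together with the comparisons made, are
matched by the LCPs written and by one comparison per game. -/
theorem outputLoop_spec {m : ℕ} (hK : K = 2 ^ m) {R : ℕ → Run α}
    (hR : ∀ k ∈ Finset.Icc 1 K, (R k).IsSorted) (N : ℕ) (i : ℕ → ℕ) (w : ℕ) (T : LoserTree)
    (prev : List α) (hT : Played K (fun k => (R k).strs[i k]?) T m 1 w)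
    (hN : N = ∑ k ∈ Finset.Icc 1 K, ((R k).strs.drop (i k)).length)
    (hle : LeO (some prev) (R w).strs[i w]?) {h1 : ℕ} (hh1 : h1 = lcpO (some prev) (R w).strs[i w]?) :
    (prev :: (outputLoop K R N i w h1 T).val.strs).Pairwise (· ≤ ·) ∧
    ((outputLoop K R N i w h1 T).val.strs : Multiset (List α)) =
      ∑ k ∈ Finset.Icc 1 K, (((R k).strs.drop (i k) : List (List α)) : Multiset (List α)) ∧
    (outputLoop K R N i w h1 T).val.lcps = lcpsFrom prev (outputLoop K R N i w h1 T).val.strs ∧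
    (outputLoop K R N i w h1 T).cmps + h1 + treeSum T m 1 +
        ∑ k ∈ Finset.Icc 1 K, ((R k).lcps.drop (i k + 1)).sum ≤
      N * m + (outputLoop K R N i w h1 T).val.lcps.sum ∧
    (outputLoop K R N i w h1 T).steps =
      (outputLoop K R N i w h1 T).cmps + N * (3 * m + 2) + 1 := by
  have hw := hT.mem_Icc hK
  induction N generalizing i w T prev h1 with
  | zero =>
    have hdrop : ∀ k ∈ Finset.Icc 1 K, (R k).strs.length ≤ i k := fun k hk => by
      have := (Finset.sum_eq_zero_iff.1 hN.symm) k hk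
      rw [List.length_drop] at this
      omega
    have hnone : ∀ k ∈ Finset.Icc 1 K, (R k).strs[i k]? = none := fun k hk =>
      List.getElem?_eq_none (hdrop k hk)
    have ht : treeSum T m 1 = 0 := hT.treeSum_eq_zero fun v k hv hv' => by
      apply hnone
      rw [← hK] at hv'
      have h1 := Nat.div_add_mod v K
      have h2 := Nat.mod_lt v (show 0 < K by rw [hK]; positivity)
      rw [hv', mul_one] at h1
      rw [Finset.mem_Icc]
      omega
    have hl : ∑ k ∈ Finset.Icc 1 K, ((R k).lcps.drop (i k + 1)).sum = 0 :=
      Finset.sum_eq_zero fun k hk => by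
        rw [List.drop_eq_nil_of_le]
        · rfl
        · rw [(hR k hk).2, length_lcpArray]
          exact (hdrop k hk).trans (Nat.le_succ _)
    have hm : ∑ k ∈ Finset.Icc 1 K,
        (((R k).strs.drop (i k) : List (List α)) : Multiset (List α)) = 0 :=
      Finset.sum_eq_zero fun k hk => by rw [List.drop_eq_nil_of_le (hdrop k hk)]; rfl
    rw [hnone w hw, lcpO_none] at hh1
    rw [outputLoop, tick_bind, hm, hl, ht, hh1]
    exact ⟨List.pairwise_singleton _ _, rfl, rfl, by simp, by simp⟩
  | succ N ih =>
    -- some input has a front string, hence so has the winner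
    obtain ⟨p, hp⟩ : ∃ p, (R w).strs[i w]? = some p := by
      obtain ⟨k, hk, hk0⟩ := Finset.exists_ne_zero_of_sum_ne_zero (hN.symm.trans_ne (Nat.succ_ne_zero N))
      have hk' := Finset.mem_Icc.1 hk
      obtain ⟨e1, e2⟩ := leaf_div hK hk'.1 hk'.2
      have := hT.le e1 e2
      rw [List.length_drop] at hk0
      rw [List.getElem?_eq_getElem (l := (R k).strs) (by omega)] at this
      rcases h : (R w).strs[i w]? with _ | p
      · rw [h] at this
        exact this.elim
      · exact ⟨p, rfl⟩
    set i' := Function.update i w (i w + 1) with hi'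
    have hiw : i' w = i w + 1 := by simp [hi']
    have hik : ∀ k, k ≠ w → i' k = i k := fun k hk => by simp [hi', hk]
    obtain ⟨hlt, hget⟩ := List.getElem?_eq_some_iff.1 hp
    have hdrop : (R w).strs.drop (i w) = p :: (R w).strs.drop (i' w) := by
      rw [hiw, ← hget]
      exact List.drop_eq_getElem_cons hlt
    have hle' : LeO (some p) (R w).strs[i' w]? := by
      rcases h : (R w).strs[i' w]? with _ | q
      · trivial
      · obtain ⟨hlt', hget'⟩ := List.getElem?_eq_some_iff.1 h
        have := List.pairwise_iff_getElem.1 (hR w hw).1 (i w) (i' w) hlt hlt' (by omega)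
        rwa [hget, hget'] at this
    have hlcp : (R w).lcps.getD (i' w) 0 = lcpO (some p) (R w).strs[i' w]? := by
      rw [(hR w hw).2, hiw, getD_lcpArray_succ, hp]
    obtain ⟨x, T', c, e, hx, hpx, -, hc⟩ := replay_subtree (K := K) (T := T) (p := p) (w := w) (j := m)
      (u := 1) (s := fun k => (R k).strs[i k]?) (s' := fun k => (R k).strs[i' k]?)
      (fun k hk => by simp only [hik k hk]) hp hle' le_rfl hT
    have hN' : N = ∑ k ∈ Finset.Icc 1 K, ((R k).strs.drop (i' k)).length := by
      have := sum_eq_add_of_eq_off (c := 1) hw (f := fun k => ((R k).strs.drop (i k)).length)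
        (g := fun k => ((R k).strs.drop (i' k)).length) (fun k hk => by simp only [hik k hk])
        (by simp only [hdrop, List.length_cons]; omega)
      omega
    have hM := sum_eq_add_of_eq_off (c := ({p} : Multiset (List α))) hw
      (f := fun k => (((R k).strs.drop (i k) : List (List α)) : Multiset (List α)))
      (g := fun k => (((R k).strs.drop (i' k) : List (List α)) : Multiset (List α)))
      (fun k hk => by simp only [hik k hk]) (by simp only [hdrop]; rfl)
    have hL := sum_eq_add_of_eq_off (c := lcpO (some p) (R w).strs[i' w]?) hw
      (f := fun k => ((R k).lcps.drop (i k + 1)).sum)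
      (g := fun k => ((R k).lcps.drop (i' k + 1)).sum)
      (fun k hk => by simp only [hik k hk]) (by
        change ((R w).lcps.drop (i w + 1)).sum = _ + ((R w).lcps.drop (i' w + 1)).sum
        rw [← hlcp, hiw]
        by_cases h : i w + 1 < (R w).lcps.length
        · rw [List.drop_eq_getElem_cons h, List.sum_cons, List.getD_eq_getElem _ _ h]
        · rw [List.drop_eq_nil_of_le (by omega), List.drop_eq_nil_of_le (by omega),
            List.getD_eq_default _ _ (by omega)]
          rfl)
    obtain ⟨o1, o2, o3, o4, o5⟩ := ih i' x T' p hx hN' hpx rfl (hx.mem_Icc hK)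
    have hO : outputLoop K R (N + 1) i w h1 T =
        ⟨⟨p :: (outputLoop K R N i' x (lcpO (some p) (R x).strs[i' x]?) T').val.strs,
          h1 :: (outputLoop K R N i' x (lcpO (some p) (R x).strs[i' x]?) T').val.lcps⟩,
          c + (outputLoop K R N i' x (lcpO (some p) (R x).strs[i' x]?) T').cmps,
          c + (3 * m + 2) + (outputLoop K R N i' x (lcpO (some p) (R x).strs[i' x]?) T').steps⟩ := by
      have e' : replay (fun k => (R k).strs[i' k]?) (K + w) w ((R w).lcps.getD (i' w) 0) T =
          ⟨(x, lcpO (some p) (R x).strs[i' x]?, T'), c, c + 3 * m + 1⟩ := by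
        rw [hlcp, e, replay, dif_neg (by omega)]
        rfl
      rw [outputLoop]
      simp only [← hi', e', hp]
      simp only [bind_eq_charge, tick, charge, val_pure, cmps_pure, steps_pure, Option.getD_some]
      congr 1
      · omega
      · omega
    set O := outputLoop K R N i' x (lcpO (some p) (R x).strs[i' x]?) T' with hOdef
    rw [hp] at hle hh1
    rw [hO]
    refine ⟨?_, ?_, ?_, ?_, ?_⟩
    · refine List.pairwise_cons.2 ⟨?_, o1⟩
      intro a ha
      rcases List.mem_cons.1 ha with rfl | ha
      · exact hle
      · exact le_trans hle ((List.pairwise_cons.1 o1).1 a ha)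
    · rw [hM, ← o2]; rfl
    · simp only [lcpsFrom, ← o3, hh1]; rfl
    · rw [hL]
      simp only [List.sum_cons]
      have : (N + 1) * m = N * m + m := by ring
      omega
    · simp only
      have : (N + 1) * (3 * m + 2) = N * (3 * m + 2) + (3 * m + 2) := by ring
      omega

/-! ### The merge -/

/-- One merge. The comparisons and the LCPs of the inputs are matched by the LCPs of the output, one
comparison for every string and level, and one for every nonempty input but one. -/
theorem kwayMerge_spec {m : ℕ} (hK : K = 2 ^ m) {R : ℕ → Run α}
    (hR : ∀ k ∈ Finset.Icc 1 K, (R k).IsSorted) {N : ℕ} (hN0 : 0 < N)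
    (hN : ∑ k ∈ Finset.Icc 1 K, (R k).strs.length = N) :
    (kwayMerge K 0 R).val.IsSorted ∧
    ((kwayMerge K 0 R).val.strs : Multiset (List α)) =
      ∑ k ∈ Finset.Icc 1 K, ((R k).strs : Multiset (List α)) ∧
    (kwayMerge K 0 R).cmps + 1 + ∑ k ∈ Finset.Icc 1 K, (R k).lcps.sum ≤
      N * m + (kwayMerge K 0 R).val.lcps.sum + ∑ k ∈ Finset.Icc 1 K, real (R k).strs[0]? ∧
    (kwayMerge K 0 R).steps + 1 = (kwayMerge K 0 R).cmps + N * (3 * m + 2) + 7 * K := by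
  obtain ⟨x, T, c, t, ht, e, hT, -, hc⟩ := build_subtree (K := K) (j := m) (u := 1) (k₀ := 1)
    (s := fun k => (R k).strs[0]?) (T := ⟨fun _ => 0, fun _ => 0⟩) le_rfl (by omega)
    (fun _ _ => rfl) []
  set T₁ := T.set 1 x 0 with hT₁
  have e' : build K 0 (fun k => (R k).strs[0]?) (List.range' 1 K) ⟨fun _ => 0, fun _ => 0⟩ =
      ⟨T₁, c, c + t + 2⟩ := by
    rw [List.append_nil, ← hK] at e
    rw [e, buildUp, dif_neg (by omega)]
    rfl
  have hoff : ∀ v, InSubtree 1 v → T₁.y (v + 1) = T.y (v + 1) ∧ T₁.h (v + 1) = T.h (v + 1) := by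
    intro v hv
    have : v ≠ 0 := by have := hv.le; omega
    simp [hT₁, LoserTree.set, this]
  have hy : T₁.y 1 = x := by simp [hT₁, LoserTree.set]
  have hh : T₁.h 1 = 0 := by simp [hT₁, LoserTree.set]
  have hP := (hT.congr (fun _ _ _ _ => rfl) hoff).1
  obtain ⟨o1, o2, o3, o4, o5⟩ := outputLoop_spec hK hR N (fun _ => 0) x T₁ [] hP
    (by simpa using hN.symm) (by simp) (h1 := 0) (by simp)
  have hM : kwayMerge K 0 R = charge c (c + t + 2 + 2 * K) (outputLoop K R N (fun _ => 0) x 0 T₁) := by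
    rw [kwayMerge]
    simp only [hN, e', hy, hh, bind_eq_charge, tick, charge]
    congr 1
    · omega
    · omega
  rw [lcpsFrom_nil] at o3
  have hx1 : real (R x).strs[0]? = 1 := by
    obtain ⟨k, hk, hk0⟩ := Finset.exists_ne_zero_of_sum_ne_zero (hN.trans_ne hN0.ne')
    have hk' := Finset.mem_Icc.1 hk
    obtain ⟨e1, e2⟩ := leaf_div hK hk'.1 hk'.2
    have h1 := (hT.le e1 e2).real_le
    have h2 := real_le_one (R x).strs[0]?
    rw [List.getElem?_eq_getElem (l := (R k).strs) (by omega)] at h1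
    exact le_antisymm h2 h1
  have hreal : ((List.range' 1 (2 ^ m)).map fun k => real (R k).strs[0]?).sum =
      ∑ k ∈ Finset.Icc 1 K, real (R k).strs[0]? := by
    rw [← hK]; rfl
  have hlcps : ∑ k ∈ Finset.Icc 1 K, ((R k).lcps.drop (0 + 1)).sum =
      ∑ k ∈ Finset.Icc 1 K, (R k).lcps.sum :=
    Finset.sum_congr rfl fun k hk => by
      rw [(hR k hk).2]
      cases (R k).strs <;> simp [lcpArray]
  have htree := treeSum_congr (j := m) hoff
  rw [hM]
  refine ⟨⟨(List.pairwise_cons.1 o1).2, o3⟩, by simpa using o2, ?_, ?_⟩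
  · simp only [val_charge, cmps_charge]
    omega
  · simp only [cmps_charge, steps_charge]
    omega

/-! ### The recursion -/

theorem sum_part {β : Type} {K : ℕ} (hK : 0 < K) (S : List β) :
    ∑ k ∈ Finset.range K, ((part K S k : List β) : Multiset β) = S := by
  have key : ∀ j, ∑ k ∈ Finset.range j, ((part K S k : List β) : Multiset β) =
      (S.take (j * (S.length / K) + min j (S.length % K)) : List β) := by
    intro j
    induction j with
    | zero => simp
    | succ j ih =>
      have h : (j + 1) * (S.length / K) + min (j + 1) (S.length % K) =
          (j * (S.length / K) + min j (S.length % K)) +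
            (S.length / K + if j < S.length % K then 1 else 0) := by
        rw [Nat.succ_mul]
        split_ifs <;> omega
      rw [Finset.sum_range_succ, ih, h,
        List.take_add (i := j * (S.length / K) + min j (S.length % K)), ← Multiset.coe_add]
      rfl
  rw [key K, List.take_of_length_le]
  have h1 := Nat.div_add_mod S.length K
  have h2 := Nat.mod_lt S.length hK
  omega

theorem length_part_le {β : Type} {K : ℕ} (hK : 0 < K) (S : List β) (k : ℕ) :
    (part K S k).length ≤ (S.length + K - 1) / K := by
  refine (List.length_take_le _ _).trans ?_
  rw [Nat.le_div_iff_mul_le hK]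
  have h1 := Nat.div_add_mod S.length K
  rw [Nat.add_mul, Nat.mul_comm (S.length / K)]
  split_ifs <;> omega

theorem length_part_of_eq_mul {β : Type} {K k n : ℕ} (hK : 0 < K) (S : List β) (hS : S.length = K * n)
    (hk : k < K) : (part K S k).length = n := by
  have h : (k + 1) * n ≤ K * n := Nat.mul_le_mul_right n hk
  rw [Nat.succ_mul] at h
  simp only [part, hS, Nat.mul_div_cancel_left n hK, Nat.mul_mod_right, List.length_take,
    List.length_drop, Nat.min_zero, Nat.not_lt_zero, if_false]
  omega

theorem sum_Icc_one_pred {M : Type} [AddCommMonoid M] (f : ℕ → M) (K : ℕ) :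
    ∑ k ∈ Finset.Icc 1 K, f (k - 1) = ∑ k ∈ Finset.range K, f k := by
  induction K with
  | zero => simp
  | succ K ih => rw [Finset.sum_Icc_succ_top (by omega), ih, Finset.sum_range_succ]; rfl

/-- One level of the recursion, provided that the parts have been sorted. -/
theorem mergesort_step {K m : ℕ} (hK : K = 2 ^ m) (hm : 1 ≤ m) (S : List (List α))
    (hS : 2 ≤ S.length)
    (hR : ∀ k < K, (mergesort K (part K S k)).val.IsSorted ∧
      ((mergesort K (part K S k)).val.strs : Multiset (List α)) = part K S k) :
    (mergesort K S).val.IsSorted ∧ ((mergesort K S).val.strs : Multiset (List α)) = S ∧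
    (mergesort K S).cmps + 1 + ∑ k ∈ Finset.range K, (mergesort K (part K S k)).val.lcps.sum ≤
      S.length * m + (mergesort K S).val.lcps.sum +
        ∑ k ∈ Finset.range K, ((mergesort K (part K S k)).cmps +
          real (mergesort K (part K S k)).val.strs[0]?) ∧
    (mergesort K S).steps + ∑ k ∈ Finset.range K, (mergesort K (part K S k)).cmps =
      (mergesort K S).cmps + ∑ k ∈ Finset.range K, (mergesort K (part K S k)).steps +
        S.length * (3 * m + 2) + 8 * K + 1 := by
  have hK2 : 2 ≤ K := by
    rw [hK]
    exact Nat.le_self_pow (by omega) 2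
  set f : ℕ → Counted (Run α) := fun k => mergesort K (part K S k) with hf
  set R : ℕ → Run α := fun k => ((List.range K).map fun k => (f k).val).getD (k - 1) ⟨[], []⟩ with hRdef
  have hRk : ∀ k ∈ Finset.Icc 1 K, R k = (f (k - 1)).val := fun k hk => by
    rw [Finset.mem_Icc] at hk
    simp only [hRdef, List.getD_eq_getElem?_getD, List.getElem?_map]
    rw [List.getElem?_range (by omega)]
    rfl
  have hsum : ∀ {M : Type} [AddCommMonoid M] (g : Run α → M),
      ∑ k ∈ Finset.Icc 1 K, g (R k) = ∑ k ∈ Finset.range K, g (f k).val := fun g => by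
    rw [← sum_Icc_one_pred]
    exact Finset.sum_congr rfl fun k hk => by rw [hRk k hk]
  have hms : ∑ k ∈ Finset.range K, ((f k).val.strs : Multiset (List α)) = S := by
    rw [← sum_part (show 0 < K by omega) S]
    exact Finset.sum_congr rfl fun k hk => (hR k (Finset.mem_range.1 hk)).2
  have hN : ∑ k ∈ Finset.Icc 1 K, (R k).strs.length = S.length := by
    have h := congrArg Multiset.card hms
    rw [Multiset.card_sum] at h
    rw [hsum fun r => r.strs.length]
    simpa using h
  obtain ⟨o1, o2, o3, o4⟩ := kwayMerge_spec hK (R := R) (fun k hk => by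
    rw [hRk k hk]
    rw [Finset.mem_Icc] at hk
    exact (hR (k - 1) (by omega)).1) (by omega : 0 < S.length) hN
  rw [hsum fun r => (r.strs : Multiset (List α)), hms] at o2
  rw [hsum fun r => r.lcps.sum, hsum fun r => real r.strs[0]?] at o3
  have hM : mergesort K S = charge (∑ k ∈ Finset.range K, (f k).cmps)
      (∑ k ∈ Finset.range K, (f k).steps + K + 2) (kwayMerge K 0 R) := by
    rw [mergesort]
    simp only [dif_pos (And.intro hK2 hS), collect_eq, bind_eq_charge, charge_charge]
    rw [List.length_range]
    change charge (0 + ∑ k ∈ Finset.range K, (f k).cmps)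
      (1 + (∑ k ∈ Finset.range K, (f k).steps + K + 1)) (kwayMerge K 0 R) = _
    congr 1
    · omega
    · omega
  have hfe : ∀ k, mergesort K (part K S k) = f k := fun _ => rfl
  rw [hM]
  simp only [val_charge, cmps_charge, steps_charge, hfe]
  rw [Finset.sum_add_distrib]
  exact ⟨o1, o2, by omega, by omega⟩

theorem mergesort_of_length_le_one {K : ℕ} {S : List (List α)} (hS : S.length ≤ 1) :
    mergesort K S = ⟨⟨S, S.map fun _ => 0⟩, 0, 1⟩ := by
  rw [mergesort, dif_neg (by omega)]
  rfl

theorem isSorted_of_length_le_one {S : List (List α)} (hS : S.length ≤ 1) :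
    (⟨S, S.map fun _ => 0⟩ : Run α).IsSorted := by
  match S, hS with
  | [], _ => exact ⟨List.Pairwise.nil, rfl⟩
  | [s], _ => exact ⟨List.pairwise_singleton _ _, rfl⟩

theorem clog_length_part {β : Type} {K : ℕ} (hK : 2 ≤ K) (S : List β) (hS : 2 ≤ S.length) (k : ℕ) :
    Nat.clog K (part K S k).length + 1 ≤ Nat.clog K S.length := by
  rw [Nat.clog_of_two_le (by omega) hS]
  exact Nat.succ_le_succ (Nat.clog_mono_right K (length_part_le (by omega) S k))

theorem sum_length_part {β : Type} {K : ℕ} (hK : 0 < K) (S : List β) :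
    ∑ k ∈ Finset.range K, (part K S k).length = S.length := by
  have h := congrArg Multiset.card (sum_part hK S)
  rw [Multiset.card_sum] at h
  simpa using h

/-- Correctness, and the number of comparisons. The summand `real _` saves one comparison for a
nonempty sequence; summed over the parts it pays for the initial tournament of the merge. -/
theorem mergesort_spec {K m : ℕ} (hK : K = 2 ^ m) (hm : 1 ≤ m) (S : List (List α)) :
    (mergesort K S).val.IsSorted ∧ ((mergesort K S).val.strs : Multiset (List α)) = S ∧
    (mergesort K S).cmps + real (mergesort K S).val.strs[0]? ≤
      (mergesort K S).val.lcps.sum + S.length * (Nat.clog K S.length * m) + S.length := by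
  have hK2 : 2 ≤ K := by
    rw [hK]
    exact Nat.le_self_pow (by omega) 2
  induction hn : S.length using Nat.strong_induction_on generalizing S with
  | _ n ih =>
  subst hn
  rcases Nat.lt_or_ge S.length 2 with hS | hS
  · rw [mergesort_of_length_le_one (by omega)]
    refine ⟨isSorted_of_length_le_one (by omega), rfl, ?_⟩
    match S, hS with
    | [], _ => simp [real]
    | [s], _ => simp [real]
  · have ih' := fun k => ih _ (length_part_lt K S k hK2 hS) (part K S k) rfl
    obtain ⟨o1, o2, o3, -⟩ := mergesort_step hK hm S hS fun k _ => ⟨(ih' k).1, (ih' k).2.1⟩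
    refine ⟨o1, o2, ?_⟩
    obtain ⟨c, hc⟩ : ∃ c, Nat.clog K S.length = c + 1 :=
      ⟨_, Nat.clog_of_two_le (by omega) hS⟩
    have h := Finset.sum_le_sum fun k (_ : k ∈ Finset.range K) => (ih' k).2.2.trans
      (Nat.add_le_add_right (Nat.add_le_add_left (Nat.mul_le_mul_left _ (Nat.mul_le_mul_right m
        (show Nat.clog K (part K S k).length ≤ c by
          have := clog_length_part hK2 S hS k
          omega))) _) _)
    rw [Finset.sum_add_distrib (g := fun k => (part K S k).length), Finset.sum_add_distrib
      (g := fun k => (part K S k).length * (c * m)), ← Finset.sum_mul,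
      sum_length_part (by omega)] at h
    have h1 := real_le_one (mergesort K S).val.strs[0]?
    have h2 : S.length * ((c + 1) * m) = S.length * (c * m) + S.length * m := by ring
    rw [hc, h2]
    omega

/-- The steps other than comparisons, for an arbitrary number of strings: the setup of a merge, linear
in `K`, is charged to each of its strings. -/
theorem mergesort_steps_le {K m : ℕ} (hK : K = 2 ^ m) (hm : 1 ≤ m) (S : List (List α)) :
    (mergesort K S).steps ≤ (mergesort K S).cmps + 1 +
      S.length * Nat.clog K S.length * (9 * K + 3 * m + 2) := by
  have hK2 : 2 ≤ K := by
    rw [hK]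
    exact Nat.le_self_pow (by omega) 2
  induction hn : S.length using Nat.strong_induction_on generalizing S with
  | _ n ih =>
  subst hn
  rcases Nat.lt_or_ge S.length 2 with hS | hS
  · rw [mergesort_of_length_le_one (by omega)]
    exact Nat.le_add_right _ _
  · have ih' := fun k => ih _ (length_part_lt K S k hK2 hS) (part K S k) rfl
    obtain ⟨-, -, -, o⟩ := mergesort_step hK hm S hS fun k _ =>
      ⟨(mergesort_spec hK hm _).1, (mergesort_spec hK hm _).2.1⟩
    obtain ⟨c, hc⟩ : ∃ c, Nat.clog K S.length = c + 1 :=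
      ⟨_, Nat.clog_of_two_le (by omega) hS⟩
    have h := Finset.sum_le_sum fun k (_ : k ∈ Finset.range K) => (ih' k).trans
      (Nat.add_le_add_left (Nat.mul_le_mul_right (9 * K + 3 * m + 2) (Nat.mul_le_mul_left _
        (show Nat.clog K (part K S k).length ≤ c by
          have := clog_length_part hK2 S hS k
          omega))) _)
    rw [Finset.sum_add_distrib, Finset.sum_add_distrib, ← Finset.sum_mul, ← Finset.sum_mul,
      sum_length_part (by omega), Finset.sum_const, Finset.card_range, smul_eq_mul, mul_one] at h
    have h2 : S.length * (c + 1) * (9 * K + 3 * m + 2) =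
        S.length * c * (9 * K + 3 * m + 2) + S.length * (3 * m + 2) + S.length * (9 * K) := by ring
    have h3 : 1 * (9 * K) ≤ S.length * (9 * K) := Nat.mul_le_mul_right _ (by omega)
    rw [hc, h2]
    omega

/-- For `K ^ d` strings every merge has at least `K` strings, so that the cost of setting up the merges
is linear in the number of strings, independently of `K`. -/
theorem mergesort_steps_le_of_pow {K m : ℕ} (hK : K = 2 ^ m) (hm : 1 ≤ m) (d : ℕ)
    (S : List (List α)) (hS : S.length = K ^ d) :
    (mergesort K S).steps + 17 ≤
      (mergesort K S).cmps + K ^ d * d * (3 * m + 2) + 18 * K ^ d := by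
  have hK2 : 2 ≤ K := by
    rw [hK]
    exact Nat.le_self_pow (by omega) 2
  induction d generalizing S with
  | zero =>
    rw [mergesort_of_length_le_one (by rw [hS, pow_zero])]
    simp
  | succ d ih =>
    have hpow : 1 ≤ K ^ d := Nat.one_le_pow _ _ (by omega)
    have hS2 : 2 ≤ S.length := by
      rw [hS, pow_succ]
      exact le_trans hK2 (Nat.le_mul_of_pos_left K hpow)
    have h := Finset.sum_le_sum fun k (hk : k ∈ Finset.range K) => ih (part K S k)
      (length_part_of_eq_mul (by omega) S (hS.trans (pow_succ' K d)) (Finset.mem_range.1 hk))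
    obtain ⟨-, -, -, o⟩ := mergesort_step hK hm S hS2 fun k _ =>
      ⟨(mergesort_spec hK hm _).1, (mergesort_spec hK hm _).2.1⟩
    simp only [Finset.sum_add_distrib, Finset.sum_const, Finset.card_range, smul_eq_mul] at h
    have h1 : K * (K ^ d * d * (3 * m + 2)) + K ^ (d + 1) * (3 * m + 2) =
        K ^ (d + 1) * (d + 1) * (3 * m + 2) := by ring
    have h2 : K * (18 * K ^ d) = 18 * K ^ (d + 1) := by ring
    rw [hS] at o
    omega

/-! ### Distinguishing prefixes -/

theorem lcpSum_eq {K m : ℕ} (hK : K = 2 ^ m) (hm : 1 ≤ m) (S : List (List α)) :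
    (mergesort K S).val.lcps.sum = lcpSum S := by
  obtain ⟨⟨h1, h2⟩, h3, -⟩ := mergesort_spec hK hm S
  have h4 : (mergesort K S).val.strs = S.insertionSort (· ≤ ·) :=
    ((Multiset.coe_eq_coe.1 h3).trans (List.perm_insertionSort _ S).symm).eq_of_pairwise
      (fun _ _ _ _ => le_antisymm) h1 (List.pairwise_insertionSort _ S)
  rw [lcpSum, ← h4, h2]
  cases (mergesort K S).val.strs <;> simp [lcpArray]

theorem getD_lcpArray_zero (l : List (List α)) : (lcpArray l).getD 0 0 = 0 := by
  cases l <;> simp [lcpArray]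

theorem sum_tail_lcpArray (l : List (List α)) :
    (lcpArray l).tail.sum = ∑ i : Fin l.length, (lcpArray l).getD i 0 := by
  have h : (lcpArray l).tail.sum = (lcpArray l).sum := by cases l <;> simp [lcpArray]
  rw [h, ← Fin.sum_univ_getElem]
  refine Fintype.sum_equiv (finCongr (length_lcpArray l)) _ _ fun i => ?_
  simp

/-- In sorted order, the LCP of a string with its predecessor is less than the number of characters
that tell the two apart. -/
theorem lcpSum_le_distPrefixSize (S : List (List α)) : lcpSum S ≤ distPrefixSize S := by
  have hperm : (List.ofFn (S.get ∘ Tuple.sort S.get)).Perm S := by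
    simpa using Equiv.Perm.ofFn_comp_perm (Tuple.sort S.get) S.get
  have hsort : S.insertionSort (· ≤ ·) = List.ofFn (S.get ∘ Tuple.sort S.get) :=
    ((List.perm_insertionSort _ S).trans hperm.symm).eq_of_pairwise
      (fun _ _ _ _ => le_antisymm) (List.pairwise_insertionSort _ S)
      (List.pairwise_ofFn.2 fun _ _ h => Tuple.monotone_sort S.get h.le)
  obtain ⟨t, ht, e, he⟩ : ∃ t, S.insertionSort (· ≤ ·) = t ∧
      ∃ e : Fin t.length ≃ Fin S.length, ∀ i, t.get i = S.get (e i) :=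
    ⟨_, hsort, (finCongr List.length_ofFn).trans (Tuple.sort S.get), fun i => by
      rw [List.get_ofFn]; rfl⟩
  have hsum : lcpSum S = ∑ i : Fin t.length, (lcpArray t).getD i 0 := by
    rw [lcpSum, ht, sum_tail_lcpArray]
  rw [hsum, distPrefixSize, ← e.sum_comp]
  refine Finset.sum_le_sum fun i _ => ?_
  obtain ⟨i, hi⟩ := i
  cases i with
  | zero =>
    exact (getD_lcpArray_zero t).trans_le (Nat.zero_le _)
  | succ i =>
    have hj : (⟨i, by omega⟩ : Fin t.length) ≠ ⟨i + 1, hi⟩ := by simp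
    refine le_trans ?_ (Finset.le_sup (f := fun j => lcp (S.get (e ⟨i + 1, hi⟩)) (S.get j) + 1)
      (Finset.mem_erase.2 ⟨e.injective.ne hj, Finset.mem_univ _⟩))
    simp only [getD_lcpArray_succ, ← he, List.getElem?_eq_getElem hi,
      List.getElem?_eq_getElem (show i < t.length by omega), lcpO, List.get_eq_getElem]
    rw [lcp_comm]
    exact Nat.le_succ _

/-! ### The bounds in terms of real logarithms -/

theorem real_getElem?_zero {β : Type} {l : List (List β)} (h : 1 ≤ l.length) : real l[0]? = 1 := by
  rw [List.getElem?_eq_getElem (by omega)]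
  rfl

theorem length_mergesort {K m : ℕ} (hK : K = 2 ^ m) (hm : 1 ≤ m) (S : List (List α)) :
    (mergesort K S).val.strs.length = S.length :=
  (Multiset.coe_eq_coe.1 (mergesort_spec hK hm S).2.1).length_eq

theorem mergesort_cmps_lt {K m : ℕ} (hK : K = 2 ^ m) (hm : 1 ≤ m) (S : List (List α))
    (hS : 1 ≤ S.length) :
    (mergesort K S).cmps < lcpSum S + S.length * (Nat.clog K S.length * m) + S.length := by
  obtain ⟨-, -, h⟩ := mergesort_spec hK hm S
  rw [real_getElem?_zero (by rwa [length_mergesort hK hm]), lcpSum_eq hK hm] at h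
  omega

theorem mergesort_cmps_lt_logb {K m : ℕ} (hK : K = 2 ^ m) (hm : 1 ≤ m) (S : List (List α))
    (hS : 1 ≤ S.length) :
    ((mergesort K S).cmps : ℝ) <
      (lcpSum S : ℝ) + (S.length : ℝ) * (⌈Real.logb K S.length⌉ : ℝ) * Real.logb 2 K +
        (S.length : ℝ) + (⌈((S.length : ℝ) - 1) / ((K : ℝ) - 1)⌉ : ℝ) := by
  have h1 : (⌈Real.logb K S.length⌉ : ℝ) = (Nat.clog K S.length : ℝ) := by
    rw [Real.ceil_logb_natCast (Nat.cast_nonneg _), Int.clog_natCast, Int.cast_natCast]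
  have h2 : Real.logb 2 K = m := by
    rw [hK, Nat.cast_pow, Nat.cast_ofNat, Real.logb_pow, Real.logb_self_eq_one one_lt_two, mul_one]
  have h3 : (0 : ℝ) ≤ (⌈((S.length : ℝ) - 1) / ((K : ℝ) - 1)⌉ : ℝ) := by
    have hK1 : (1 : ℝ) ≤ K := by
      rw [hK]
      exact_mod_cast Nat.one_le_two_pow
    have hS1 : (1 : ℝ) ≤ S.length := by exact_mod_cast hS
    exact_mod_cast Int.ceil_nonneg (div_nonneg (sub_nonneg.2 hS1) (sub_nonneg.2 hK1))
  have h4 : ((mergesort K S).cmps : ℝ) <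
      lcpSum S + S.length * (Nat.clog K S.length * m) + S.length := by
    exact_mod_cast mergesort_cmps_lt hK hm S hS
  rw [h1, h2, mul_assoc]
  linarith

theorem clog_le_two_mul_logb {K m n : ℕ} (hK : K = 2 ^ m) (hm : 1 ≤ m) (hn : 2 ≤ n) :
    (Nat.clog K n : ℝ) ≤ 2 * Real.logb 2 n := by
  have h1 : (1 : ℝ) ≤ Real.logb 2 n := by
    rw [Real.le_logb_iff_rpow_le one_lt_two (by positivity), Real.rpow_one]
    exact_mod_cast hn
  -- logarithms to the base `2` are the largest of all `K`
  have h2 : (Nat.clog K n : ℝ) ≤ Nat.clog 2 n := by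
    have : 2 ≤ K := hK ▸ Nat.le_self_pow (by omega) 2
    exact_mod_cast Nat.clog_anti_left one_lt_two this
  have h3 : (Nat.clog 2 n : ℝ) < Real.logb 2 n + 1 := by
    rw [← Real.natCeil_logb_natCast]
    exact_mod_cast Nat.ceil_lt_add_one (zero_le_one.trans h1)
  linarith

theorem mergesort_steps_le_logb {K m : ℕ} (hK : K = 2 ^ m) (hm : 1 ≤ m) (S : List (List α))
    (hS : 2 ≤ S.length) :
    ((mergesort K S).steps : ℝ) ≤ (2 * m + 2 + 2 * (9 * K + 3 * m + 2)) *
      ((distPrefixSize S : ℝ) + (S.length : ℝ) * Real.logb 2 S.length) := by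
  have h1 : (1 : ℝ) ≤ Real.logb 2 S.length := by
    rw [Real.le_logb_iff_rpow_le one_lt_two (by positivity), Real.rpow_one]
    exact_mod_cast hS
  have h2 := clog_le_two_mul_logb hK hm hS
  have hc := mergesort_cmps_lt hK hm S (by omega)
  have hs := mergesort_steps_le hK hm S
  have hD := lcpSum_le_distPrefixSize S
  have h3 : ((mergesort K S).steps : ℝ) ≤ distPrefixSize S +
      S.length * Nat.clog K S.length * (m + (9 * K + 3 * m + 2)) + S.length := by
    have : (mergesort K S).steps ≤ distPrefixSize S +
        S.length * Nat.clog K S.length * (m + (9 * K + 3 * m + 2)) + S.length := by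
      rw [Nat.mul_add, Nat.mul_assoc _ _ m]
      omega
    exact_mod_cast this
  have h4 : (S.length : ℝ) * Nat.clog K S.length ≤ S.length * (2 * Real.logb 2 S.length) :=
    mul_le_mul_of_nonneg_left h2 (Nat.cast_nonneg _)
  have h5 : (S.length : ℝ) * 1 ≤ S.length * Real.logb 2 S.length :=
    mul_le_mul_of_nonneg_left h1 (Nat.cast_nonneg _)
  have h6 := mul_le_mul_of_nonneg_right h4
    (show (0 : ℝ) ≤ m + (9 * K + 3 * m + 2) by positivity)
  have h7 : (0 : ℝ) ≤ (2 * m + 1 + 2 * (9 * K + 3 * m + 2)) * distPrefixSize S := by positivity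
  have h8 : (0 : ℝ) ≤ S.length := Nat.cast_nonneg _
  linarith

theorem mergesort_steps_le_logb_of_pow {K m d : ℕ} (hK : K = 2 ^ m) (hm : 1 ≤ m) (hd : 1 ≤ d)
    (S : List (List α)) (hS : S.length = K ^ d) :
    ((mergesort K S).steps : ℝ) ≤
      25 * ((distPrefixSize S : ℝ) + (S.length : ℝ) * Real.logb 2 S.length) := by
  have hK1 : 1 < K := hK ▸ Nat.one_lt_two_pow (by omega)
  have h2 : Real.logb 2 S.length = (d * m : ℕ) := by
    rw [hS, hK, ← pow_mul, Nat.cast_pow, Nat.cast_ofNat, Real.logb_pow,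
      Real.logb_self_eq_one one_lt_two, mul_one, mul_comm m]
  have hc := mergesort_cmps_lt hK hm S (hS ▸ Nat.one_le_pow _ _ (by omega))
  have hs := mergesort_steps_le_of_pow hK hm d S hS
  have hD := lcpSum_le_distPrefixSize S
  rw [hS, Nat.clog_pow K d hK1] at hc
  rw [h2, hS]
  have h3 : K ^ d * 1 ≤ K ^ d * (d * m) := Nat.mul_le_mul_left _ (Nat.mul_pos hd hm)
  have h4 : K ^ d * d * 1 ≤ K ^ d * d * m := Nat.mul_le_mul_left _ hm
  have h5 : K ^ d * d * (3 * m + 2) = 3 * (K ^ d * (d * m)) + 2 * (K ^ d * d * 1) := by ring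
  rw [Nat.mul_assoc _ d m] at h4
  have : (mergesort K S).steps ≤ 25 * (distPrefixSize S + K ^ d * (d * m)) := by omega
  exact_mod_cast this

end Strings

end KwayLCP

theorem mainTheorem3 :
    -- correctness and number of character comparisons
    (∀ K : ℕ, (∃ k : ℕ, 1 ≤ k ∧ K = 2 ^ k) →
      ∀ (σ n : ℕ) (S : List (List (Fin σ))), S.length = n → 1 ≤ n →
        (KwayLCP.mergesort K S).val.strs.Pairwise (· ≤ ·) ∧
        (KwayLCP.mergesort K S).val.strs.Perm S ∧
        (KwayLCP.mergesort K S).val.lcps =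
          KwayLCP.lcpArray (KwayLCP.mergesort K S).val.strs ∧
        ((KwayLCP.mergesort K S).cmps : ℝ) <
          (KwayLCP.lcpSum S : ℝ) + (n : ℝ) * (⌈Real.logb K n⌉ : ℝ) * Real.logb 2 K + (n : ℝ) +
            (⌈((n : ℝ) - 1) / ((K : ℝ) - 1)⌉ : ℝ)) ∧
    -- running time for each fixed `K`
    (∀ K : ℕ, (∃ k : ℕ, 1 ≤ k ∧ K = 2 ^ k) →
      ∃ C : ℝ, ∀ (σ n : ℕ) (S : List (List (Fin σ))), S.length = n → 2 ≤ n →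
        ((KwayLCP.mergesort K S).steps : ℝ) ≤
          C * ((KwayLCP.distPrefixSize S : ℝ) + (n : ℝ) * Real.logb 2 n)) ∧
    -- if the number of strings is a power of `K`, the constant does not depend on `K` either
    (∃ C : ℝ, ∀ K : ℕ, (∃ k : ℕ, 1 ≤ k ∧ K = 2 ^ k) →
      ∀ (σ n : ℕ) (S : List (List (Fin σ))), S.length = n → (∃ d : ℕ, 1 ≤ d ∧ n = K ^ d) →
        ((KwayLCP.mergesort K S).steps : ℝ) ≤
          C * ((KwayLCP.distPrefixSize S : ℝ) + (n : ℝ) * Real.logb 2 n)) := by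
  refine ⟨?_, ?_, 25, ?_⟩
  · rintro K ⟨m, hm, hK⟩ σ n S rfl hS
    obtain ⟨⟨h1, h2⟩, h3, -⟩ := KwayLCP.mergesort_spec hK hm S
    exact ⟨h1, Multiset.coe_eq_coe.1 h3, h2, KwayLCP.mergesort_cmps_lt_logb hK hm S hS⟩
  · rintro K ⟨m, hm, hK⟩
    refine ⟨2 * m + 2 + 2 * (9 * K + 3 * m + 2), ?_⟩
    rintro σ n S rfl hS
    exact KwayLCP.mergesort_steps_le_logb hK hm S hS
  · rintro K ⟨m, hm, hK⟩ σ n S rfl ⟨d, hd, hS⟩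
    exact KwayLCP.mergesort_steps_le_logb_of_pow hK hm hd S hS
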